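/- Let $(\Omega,\mathscr A,P)$ be a complete probability space without atoms and let $\mathbb E$ be an arbitrary (not necessarily separable) real Banach space. Let $\mathfrak C(\mathbb E)$ be the space of all nonempty closed bounded subsets of $\mathbb E$ with the Pompeiu–Hausdorff metric $h(A,B)=\max\{e(A,B),e(B,A)\}$, where $e(A,B)=\sup_{x\in A}d(x,B)$, and let $\mathfrak C_c(\mathbb E)$ be the set of its convex members; put $\|A\|=\sup_{x\in A}\|x\|$. A map is countably-valued if it takes at most countably many values, each on a set of $\mathscr A$. A random set is a map $F:\Omega\to\mathfrak C(\mathbb E)$ which is strongly measurable, i.e. there are countably-valued maps $G_n:\Omega\to\mathfrak C(\mathbb E)$ with $\operatorname{ess\,sup}_{\omega}h(G_n(\omega),F(\omega))\to0$, and which satisfies $\int_\Omega\|F\|\,dP<\infty$. Its expectation is $$E(F)=\overline{\Big\{\int_\Omega f\,dP \;:\; f:\Omega\to\mathbb E \text{ Bochner measurable},\ f(\omega)\in F(\omega)\text{ for all }\omega\in\Omega\Big\}}\in\mathfrak C_c(\mathbb E).$$ Sequences $(A_n)$ of nonempty bounded sets converge to a nonempty bounded set $C$ in the sense of Fisher if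 $e(A_n,C)\to0$ and $d(z,A_n)\to0$ for every $z\in C$. **Theorem 6.2.** Let $\mathcal U$ be a nonempty separable subset of $\mathfrak C(\mathbb E)$. Let $(X_n)_{n\ge1}$ be a sequence of random sets $X_n:\Omega\to\mathcal U$ that are independent and identically distributed (with respect to the Borel $\sigma$-algebra of $h$), with expectation $E(X_n)=C$, $n\in\mathbb N$. Suppose that for almost every $\omega\in\Omega$ there is a nonempty compact subset $\mathcal Z(\omega)$ of $\mathcal U$ such that $X_n(\omega)\in\mathcal Z(\omega)$ for all $n$. Then, for almost every $\omega\in\Omega$, $$\frac{\overline{X_1(\omega)+\dots+X_n(\omega)}}{n}\longrightarrow C\quad\text{as } n\to\infty\ \text{in the sense of Fisher.}$$ If, in addition, $C$ is compact, then, for almost every $\omega\in\Omega$, $$h\Big(\frac{\overline{X_1(\omega)+\dots+X_n(\omega)}}{n},\,C\Big)\longrightarrow0\quad\text{as } n\to\infty.$$ -/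

import Mathlib

open MeasureTheory ProbabilityTheory Filter Topology Metric
open scoped ENNReal

/-- The space of all nonempty closed bounded subsets of a metric space. -/
structure BddClosed (E : Type*) [MetricSpace E] where
  carrier : Set E
  nonempty' : carrier.Nonempty
  isClosed' : IsClosed carrier
  isBounded' : Bornology.IsBounded carrier

namespace BddClosed

variable {E : Type*} [MetricSpace E]

instance : SetLike (BddClosed E) E where
  coe := BddClosed.carrier
  coe_injective s t h := by cases s; cases t; congr

theorem nonempty (A : BddClosed E) : (A : Set E).Nonempty := A.nonempty'

theorem isClosed (A : BddClosed E) : IsClosed (A : Set E) := A.isClosed'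

theorem isBounded (A : BddClosed E) : Bornology.IsBounded (A : Set E) := A.isBounded'

theorem hausdorffEDist_ne_top (A B : BddClosed E) :
    hausdorffEDist (A : Set E) (B : Set E) ≠ ⊤ :=
  hausdorffEDist_ne_top_of_nonempty_of_bounded A.nonempty B.nonempty A.isBounded B.isBounded

/-- The Pompeiu-Hausdorff metric. -/
noncomputable instance : MetricSpace (BddClosed E) where
  dist A B := hausdorffDist (A : Set E) (B : Set E)
  dist_self _ := hausdorffDist_self_zero
  dist_comm _ _ := hausdorffDist_comm
  dist_triangle A B _ := hausdorffDist_triangle (hausdorffEDist_ne_top A B)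
  eq_of_dist_eq_zero {A B} h := SetLike.coe_injective <|
    (A.isClosed.hausdorffDist_zero_iff_eq B.isClosed (hausdorffEDist_ne_top A B)).1 h

theorem dist_def (A B : BddClosed E) :
    dist A B = hausdorffDist (A : Set E) (B : Set E) := rfl

/-- The Borel σ-algebra of the Pompeiu-Hausdorff metric. -/
noncomputable instance : MeasurableSpace (BddClosed E) := borel _

instance : BorelSpace (BddClosed E) := ⟨rfl⟩

end BddClosed

/-- Absence of atoms in the measure-theoretic sense: every measurable set of positive measure has
a measurable subset of strictly smaller positive measure. -/
def IsAtomless {Ω : Type*} [MeasurableSpace Ω] (P : Measure Ω) : Prop :=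
  ∀ A : Set Ω, MeasurableSet A → 0 < P A →
    ∃ B : Set Ω, B ⊆ A ∧ MeasurableSet B ∧ 0 < P B ∧ P B < P A

/-- A countably-valued map: it takes at most countably many values, each on a measurable set. -/
def IsCountablyValued {Ω α : Type*} [MeasurableSpace Ω] (G : Ω → α) : Prop :=
  (Set.range G).Countable ∧ ∀ a : α, MeasurableSet (G ⁻¹' {a})

/-- A map into a metric space is strongly measurable if it is a uniform almost sure limit of
countably-valued maps, that is, a limit with respect to the essential supremum of the distance. -/
def IsStronglyMeasurableMap {Ω α : Type*} [MeasurableSpace Ω] [MetricSpace α]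
    (P : Measure Ω) (F : Ω → α) : Prop :=
  ∃ G : ℕ → Ω → α, (∀ n, IsCountablyValued (G n)) ∧
    Tendsto (fun n => essSup (fun ω => edist (G n ω) (F ω)) P) atTop (𝓝 0)

section Normed

variable {E : Type*} [NormedAddCommGroup E]

/-- The norm `‖A‖ = sup {‖x‖ : x ∈ A}` of a (nonempty bounded) set. -/
noncomputable def setNorm (A : Set E) : ℝ := sSup ((fun x => ‖x‖) '' A)

/-- A random set: a strongly measurable map `F` into the nonempty closed bounded sets, with
`∫ ‖F‖ dP < ∞`. -/
structure IsRandomSet {Ω : Type*} [MeasurableSpace Ω] (P : Measure Ω) (F : Ω → BddClosed E) :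
    Prop where
  stronglyMeasurable : IsStronglyMeasurableMap P F
  integrable_norm : Integrable (fun ω => setNorm (F ω : Set E)) P

/-- The measurable (in the sense of Bochner) selectors of `F`. -/
def measurableSelectors {Ω : Type*} [MeasurableSpace Ω] (P : Measure Ω) (F : Ω → BddClosed E) :
    Set (Ω → E) :=
  {f | AEStronglyMeasurable f P ∧ ∀ ω, f ω ∈ F ω}

/-- The expectation of a random set `F`: its (closed) Aumann integral, the closure of the set of
the Bochner integrals of the measurable selectors of `F`. Each such selector `f` of a random set is
integrable, because `‖f‖ ≤ ‖F‖`. -/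
noncomputable def setExpectation [NormedSpace ℝ E] {Ω : Type*} [MeasurableSpace Ω]
    (P : Measure Ω) (F : Ω → BddClosed E) : Set E :=
  closure {y | ∃ f ∈ measurableSelectors P F, y = ∫ ω, f ω ∂P}

open scoped Pointwise in
/-- `closure (A 0 + ... + A (n - 1)) / n`, with the Minkowski sum of sets. -/
noncomputable def minkowskiMean [NormedSpace ℝ E] (A : ℕ → Set E) (n : ℕ) : Set E :=
  (n : ℝ)⁻¹ • closure (∑ i ∈ Finset.range n, A i)

/-- The excess `e(A, B) = sup {d(x, B) : x ∈ A}`. -/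
noncomputable def excess (A B : Set E) : ℝ≥0∞ := ⨆ x ∈ A, infEDist x B

/-- Convergence in the sense of Fisher: `e(A n, C) → 0`, and `d(z, A n) → 0` for all `z ∈ C`. -/
def FisherTendsto (A : ℕ → Set E) (C : Set E) : Prop :=
  Tendsto (fun n => excess (A n) C) atTop (𝓝 0) ∧
    ∀ z ∈ C, Tendsto (fun n => infEDist z (A n)) atTop (𝓝 0)

/-- Convergence in the Pompeiu-Hausdorff distance. -/
def HausdorffTendsto (A : ℕ → Set E) (C : Set E) : Prop :=
  Tendsto (fun n => hausdorffEDist (A n) C) atTop (𝓝 0)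

end Normed

/-! ### Sets of prescribed measure in an atomless space -/

section Atomless

variable {Ω : Type*} [MeasurableSpace Ω] {P : Measure Ω}

/-! The only law of large numbers needed is the real one for indicators. It first shows that the
compactness of the sample paths is deterministic: one sample almost surely visits every ball, from a
countable family, that the common law charges, so the law lives on a totally bounded set `T`
(`exists_totallyBounded_ae_mem`).

On `T` a simple map `ν` moves sets by less than `ε`, so `X n` may be replaced by `ν (X n)`, which
takes finitely many values `B`. Grouping equal summands, the Minkowski mean is then close to `∑ w B
• conv B`, where the weights `w B` are frequencies and converge to the probabilities `p B`. Each
point of a convex hull is imitated by sums of points of `B` with a bounded total error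
(`exists_norm_sum_sub_card_smul_le`), which division by `n` kills.

On the other side, `∑ p B • conv B` is close to the set of integrals of selectors: averages over
fibres fall near `conv B`, and conversely absence of atoms realizes each point of `conv B` as an
average, after which the simple function so obtained is moved into `X 0`. Compactness of `C` finally
makes the pointwise half of Fisher convergence uniform. -/

theorem IsAtomless.exists_measureReal_lt [IsFiniteMeasure P] (hP : IsAtomless P) {A : Set Ω}
    (hA : MeasurableSet A) (hA0 : 0 < P.real A) {ε : ℝ} (hε : 0 < ε) :
    ∃ B ⊆ A, MeasurableSet B ∧ 0 < P.real B ∧ P.real B < ε := by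
  have key : ∀ n : ℕ, ∃ B ⊆ A, MeasurableSet B ∧ 0 < P.real B ∧
      P.real B ≤ P.real A * (1 / 2) ^ n := by
    intro n
    induction n with
    | zero => exact ⟨A, subset_rfl, hA, hA0, by simp⟩
    | succ n ih =>
      obtain ⟨B, hBA, hB, hB0, hBn⟩ := ih
      have hB0' : 0 < P B := by
        rw [pos_iff_ne_zero]
        intro h
        simp [Measure.real, h] at hB0
      obtain ⟨D, hDB, hD, hD0, hDlt⟩ := hP B hB hB0'
      have hD0' : 0 < P.real D := ENNReal.toReal_pos hD0.ne' (measure_ne_top _ _)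
      have hDlt' : P.real D < P.real B :=
        (ENNReal.toReal_lt_toReal (measure_ne_top _ _) (measure_ne_top _ _)).2 hDlt
      have hdiff : P.real (B \ D) = P.real B - P.real D := measureReal_sdiff hDB hD
      rcases le_total (P.real D) (P.real B / 2) with h | h
      · refine ⟨D, hDB.trans hBA, hD, hD0', ?_⟩
        rw [pow_succ]; linarith
      · refine ⟨B \ D, Set.sdiff_subset.trans hBA, hB.diff hD, by linarith, ?_⟩
        rw [pow_succ]; linarith
  have hlim : Tendsto (fun n : ℕ => P.real A * (1 / 2 : ℝ) ^ n) atTop (𝓝 0) := by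
    simpa using (tendsto_pow_atTop_nhds_zero_of_lt_one (r := (1 / 2 : ℝ)) (by norm_num)
      (by norm_num)).const_mul (P.real A)
  obtain ⟨n, hn⟩ := (hlim.eventually (gt_mem_nhds hε)).exists
  obtain ⟨B, h1, h2, h3, h4⟩ := key n
  exact ⟨B, h1, h2, h3, h4.trans_lt hn⟩

/-- Sierpinski's theorem. -/
theorem IsAtomless.exists_measureReal_eq [IsFiniteMeasure P] (hP : IsAtomless P) {A : Set Ω}
    (hA : MeasurableSet A) {c : ℝ} (hc0 : 0 ≤ c) (hc : c ≤ P.real A) :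
    ∃ B ⊆ A, MeasurableSet B ∧ P.real B = c := by
  -- Greedy exhaustion: each step adds more than half of the supremum of the measures that still
  -- fit, if that supremum is positive.
  have step : ∀ B : {B : Set Ω // B ⊆ A ∧ MeasurableSet B ∧ P.real B ≤ c},
      ∃ B' : {B : Set Ω // B ⊆ A ∧ MeasurableSet B ∧ P.real B ≤ c}, B.1 ⊆ B'.1 ∧
        ∀ D ⊆ A \ B.1, MeasurableSet D → P.real B.1 + P.real D ≤ c →
          P.real D ≤ 2 * (P.real B'.1 - P.real B.1) := by
    rintro ⟨B, hBA, hB, hBc⟩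
    set S : Set ℝ := {r | ∃ D ⊆ A \ B, MeasurableSet D ∧ P.real B + P.real D ≤ c ∧ r = P.real D}
    have hbdd : BddAbove S := ⟨c, by
      rintro r ⟨D, -, -, h, rfl⟩
      linarith [measureReal_nonneg (μ := P) (s := B)]⟩
    rcases le_or_gt (sSup S) 0 with hs | hs
    · refine ⟨⟨B, hBA, hB, hBc⟩, subset_rfl, fun D hDA hD hDc => ?_⟩
      have : P.real D ≤ sSup S := le_csSup hbdd ⟨D, hDA, hD, hDc, rfl⟩
      linarith
    · have hne : S.Nonempty := ⟨_, ∅, Set.empty_subset _, MeasurableSet.empty, by simpa, rfl⟩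
      obtain ⟨_, ⟨D, hDA, hD, hDc, rfl⟩, hlt⟩ := exists_lt_of_lt_csSup hne (half_lt_self hs)
      have hdisj : Disjoint B D := Set.disjoint_left.2 fun x hx hx' => (hDA hx').2 hx
      have hun : P.real (B ∪ D) = P.real B + P.real D := measureReal_union hdisj hD
      refine ⟨⟨B ∪ D, Set.union_subset hBA (hDA.trans Set.sdiff_subset), hB.union hD,
        hun.trans_le hDc⟩, Set.subset_union_left, fun D' hDA' hD' hDc' => ?_⟩
      have : P.real D' ≤ sSup S := le_csSup hbdd ⟨D', hDA', hD', hDc', rfl⟩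
      simp only [hun]
      linarith
  choose next hsub hnext using step
  let B : ℕ → {B : Set Ω // B ⊆ A ∧ MeasurableSet B ∧ P.real B ≤ c} := fun n =>
    Nat.rec ⟨∅, Set.empty_subset _, MeasurableSet.empty, by simpa⟩ (fun _ b => next b) n
  have hmono : Monotone fun n => (B n).1 := monotone_nat_of_le_succ fun n => hsub (B n)
  have hlim : Tendsto (fun n => P.real (B n).1) atTop (𝓝 (P.real (⋃ n, (B n).1))) :=
    (ENNReal.tendsto_toReal (measure_ne_top _ _)).comp (tendsto_measure_iUnion_atTop hmono)
  have hle : P.real (⋃ n, (B n).1) ≤ c := le_of_tendsto' hlim fun n => (B n).2.2.2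
  have hm : MeasurableSet (⋃ n, (B n).1) := MeasurableSet.iUnion fun n => (B n).2.2.1
  have hsubA : (⋃ n, (B n).1) ⊆ A := Set.iUnion_subset fun n => (B n).2.1
  refine ⟨_, hsubA, hm, hle.antisymm (not_lt.1 fun hlt => ?_)⟩
  have hdiff : P.real (A \ ⋃ n, (B n).1) = P.real A - P.real (⋃ n, (B n).1) :=
    measureReal_sdiff hsubA hm
  -- If the union fell short of `c`, this `D` would fit at every stage, so its measure would be
  -- bounded by increments tending to zero.
  obtain ⟨D, hDA, hD, hD0, hDlt⟩ := hP.exists_measureReal_lt (hA.diff hm)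
    (by linarith) (sub_pos.2 hlt)
  have hbound : ∀ n, P.real D ≤ 2 * (P.real (B (n + 1)).1 - P.real (B n).1) := fun n => by
    refine hnext (B n) D (hDA.trans (Set.sdiff_subset_sdiff_right (Set.subset_iUnion (fun n => (B n).1) n))) hD ?_
    have : P.real (B n).1 ≤ P.real (⋃ n, (B n).1) := measureReal_mono (Set.subset_iUnion (fun n => (B n).1) n)
    linarith
  have hz := (((tendsto_add_atTop_iff_nat 1).2 hlim).sub hlim).const_mul 2
  rw [sub_self, mul_zero] at hz
  exact hD0.not_ge (ge_of_tendsto' hz hbound)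

end Atomless

/-! ### Points of convex hulls as averages -/

section ConvexHull

variable {E : Type*} [NormedAddCommGroup E] [NormedSpace ℝ E]

/-- On an atomless space, a point of the convex hull of `B` is the average of a `B`-valued
simple function over any given set. -/
theorem exists_setIntegral_eq_of_mem_convexHull [CompleteSpace E] {Ω : Type*} [MeasurableSpace Ω]
    {P : Measure Ω} [IsFiniteMeasure P] (hP : IsAtomless P) {B : Set E} {c : E}
    (hc : c ∈ convexHull ℝ B) {W : Set Ω} (hW : MeasurableSet W) :
    ∃ g : SimpleFunc Ω E, (∀ ω, g ω ∈ B) ∧ ∫ ω in W, g ω ∂P = P.real W • c := by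
  -- `W` is quantified inside the set because `x` and `y` are realized on complementary pieces of
  -- it, in the proportion `a : b`.
  have hsub : convexHull ℝ B ⊆ {c | ∀ W, MeasurableSet W →
      ∃ g : SimpleFunc Ω E, (∀ ω, g ω ∈ B) ∧ ∫ ω in W, g ω ∂P = P.real W • c} := by
    refine convexHull_min (fun b hb W hW => ⟨SimpleFunc.const Ω b, fun _ => hb, by simp⟩) ?_
    intro x hx y hy a b ha hb hab W hW
    obtain ⟨V, hVW, hV, hVa⟩ := hP.exists_measureReal_eq hW (mul_nonneg ha measureReal_nonneg)
      (mul_le_of_le_one_left (measureReal_nonneg (μ := P) (s := W)) (by linarith))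
    obtain ⟨g, hgB, hg⟩ := hx V hV
    obtain ⟨k, hkB, hk⟩ := hy (W \ V) (hW.diff hV)
    classical
    refine ⟨SimpleFunc.piecewise V hV g k, fun ω => ?_, ?_⟩
    · rw [SimpleFunc.piecewise_apply]
      split_ifs
      exacts [hgB ω, hkB ω]
    · have hint : ∀ s : SimpleFunc Ω E, Integrable s P := fun s => s.integrable_of_isFiniteMeasure
      rw [← Set.union_sdiff_cancel hVW, setIntegral_union Set.disjoint_sdiff_right (hW.diff hV)
        (hint _).integrableOn (hint _).integrableOn, Set.union_sdiff_cancel hVW,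
        setIntegral_congr_fun (g := g) hV fun ω hω => by simp [SimpleFunc.piecewise_apply, hω],
        setIntegral_congr_fun (g := k) (hW.diff hV)
          fun ω hω => by simp [SimpleFunc.piecewise_apply, hω.2],
        hg, hk, measureReal_sdiff hVW hV, hVa, smul_add, smul_smul, smul_smul]
      obtain rfl : b = 1 - a := by linarith
      congr 2 <;> ring
  exact hsub hc W hW

/-- A point of the convex hull of `A` is approximated, with an error of order `1 / m`, by averages
of `m` points of `A`. -/
theorem exists_norm_sum_sub_card_smul_le {A : Set E} {c : E} (hc : c ∈ convexHull ℝ A) :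
    ∃ K : ℝ, ∀ I : Finset ℕ, ∃ x : ℕ → E, (∀ i, x i ∈ A) ∧
      ‖∑ i ∈ I, x i - (I.card : ℝ) • c‖ ≤ K := by
  have hsub : convexHull ℝ A ⊆ {c | ∃ K : ℝ, ∀ I : Finset ℕ, ∃ x : ℕ → E, (∀ i, x i ∈ A) ∧
      ‖∑ i ∈ I, x i - (I.card : ℝ) • c‖ ≤ K} := by
    refine convexHull_min (fun b hb => ⟨0, fun I => ⟨fun _ => b, fun _ => hb, by
      simp [← Nat.cast_smul_eq_nsmul ℝ]⟩⟩) ?_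
    rintro x ⟨K, hx⟩ y ⟨L, hy⟩ a b ha hb hab
    -- The indices are split in the ratio `a : b` up to rounding; rounding costs at most `‖x - y‖`,
    -- whatever the size of `I`.
    refine ⟨K + L + ‖x - y‖, fun I => ?_⟩
    have hI : (0 : ℝ) ≤ a * I.card := by positivity
    have hk : ⌊a * (I.card : ℝ)⌋₊ ≤ I.card := by
      have : a * (I.card : ℝ) ≤ I.card := mul_le_of_le_one_left (by positivity) (by linarith)
      exact_mod_cast (Nat.floor_le hI).trans this
    obtain ⟨J, hJI, hJ⟩ := Finset.exists_subset_card_eq hk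
    obtain ⟨u, huA, hu⟩ := hx J
    obtain ⟨v, hvA, hv⟩ := hy (I \ J)
    classical
    refine ⟨fun i => if i ∈ J then u i else v i, fun i => ?_, ?_⟩
    · dsimp only
      split_ifs
      exacts [huA i, hvA i]
    · have hsum : ∑ i ∈ I, (if i ∈ J then u i else v i) = ∑ i ∈ J, u i + ∑ i ∈ I \ J, v i := by
        rw [← Finset.sum_sdiff hJI, add_comm]
        congr 1
        · exact Finset.sum_congr rfl fun i hi => if_pos hi
        · exact Finset.sum_congr rfl fun i hi => if_neg (Finset.mem_sdiff.1 hi).2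
      have hcard : ((I \ J).card : ℝ) = I.card - J.card := by
        rw [Finset.card_sdiff_of_subset hJI, Nat.cast_sub (Finset.card_le_card hJI)]
      have hfl : ‖((J.card : ℝ) - a * I.card) • (x - y)‖ ≤ ‖x - y‖ := by
        rw [norm_smul]
        refine mul_le_of_le_one_left (norm_nonneg _) ?_
        rw [Real.norm_eq_abs, abs_le, hJ]
        constructor
        · linarith [Nat.lt_floor_add_one (a * (I.card : ℝ))]
        · linarith [Nat.floor_le hI]
      obtain rfl : b = 1 - a := by linarith
      have hdec : ∑ i ∈ J, u i + ∑ i ∈ I \ J, v i - (I.card : ℝ) • (a • x + (1 - a) • y) =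
          (∑ i ∈ J, u i - (J.card : ℝ) • x) + (∑ i ∈ I \ J, v i - ((I \ J).card : ℝ) • y) +
            ((J.card : ℝ) - a * I.card) • (x - y) := by
        rw [hcard]
        module
      rw [hsum, hdec]
      exact (norm_add₃_le).trans (add_le_add (add_le_add hu hv) hfl)
  exact hsub hc

end ConvexHull

/-! ### Measurable selectors -/

section Selectors

theorem TotallyBounded.exists_simpleFunc_dist_lt {α : Type*} [MetricSpace α] [MeasurableSpace α]
    [OpensMeasurableSpace α] [Nonempty α] {T : Set α} (hT : TotallyBounded T) {ε : ℝ}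
    (hε : 0 < ε) : ∃ ν : SimpleFunc α α, ∀ x ∈ T, dist (ν x) x < ε := by
  obtain ⟨t, htf, ht⟩ := Metric.totallyBounded_iff.1 hT ε hε
  rcases t.eq_empty_or_nonempty with rfl | hne
  · obtain ⟨a⟩ := ‹Nonempty α›
    exact ⟨SimpleFunc.const α a, fun x hx => by simpa using ht hx⟩
  obtain ⟨e, rfl⟩ := htf.countable.exists_eq_range hne
  have hev : ∀ y ∈ Set.range e, ∀ᶠ N : ℕ in atTop, ∃ k ≤ N, e k = y := by
    rintro _ ⟨k, rfl⟩
    filter_upwards [eventually_ge_atTop k] with N hN using ⟨k, hN, rfl⟩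
  obtain ⟨N, hN⟩ := ((eventually_all_finite htf).2 hev).exists
  refine ⟨SimpleFunc.nearestPt e N, fun x hx => ?_⟩
  obtain ⟨y, hy, hxy⟩ := Set.mem_iUnion₂.1 (ht hx)
  obtain ⟨k, hk, rfl⟩ := hN y hy
  have h := SimpleFunc.edist_nearestPt_le e x hk
  rw [edist_dist, edist_dist, ENNReal.ofReal_le_ofReal_iff dist_nonneg] at h
  exact h.trans_lt (by rwa [dist_comm])

theorem BddClosed.infDist_le_add_dist {E : Type*} [MetricSpace E] (x : E) (A B : BddClosed E) :
    infDist x (B : Set E) ≤ infDist x (A : Set E) + dist A B :=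
  infDist_le_infDist_add_hausdorffDist (hausdorffEDist_ne_top A B)

theorem BddClosed.exists_dist_lt {E : Type*} [MetricSpace E] {A B : BddClosed E} {r : ℝ}
    (h : dist A B < r) {x : E} (hx : x ∈ A) : ∃ y ∈ B, dist x y < r :=
  exists_dist_lt_of_hausdorffDist_lt hx h (hausdorffEDist_ne_top A B)

/-- A simple function at distance less than `δ` from a set-valued map with totally bounded range
can be moved to a measurable selector. -/
theorem exists_measurableSelector_dist_le {E : Type*} [NormedAddCommGroup E] [CompleteSpace E]
    {Ω : Type*} [MeasurableSpace Ω] {P : Measure Ω} {X : Ω → BddClosed E} (hX : Measurable X)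
    {T : Set (BddClosed E)} (hT : TotallyBounded T) (hXT : ∀ᵐ ω ∂P, X ω ∈ T)
    (g : SimpleFunc Ω E) {δ : ℝ} (hδ : 0 < δ)
    (hg : ∀ᵐ ω ∂P, infDist (g ω) (X ω : Set E) < δ) :
    ∃ f ∈ measurableSelectors P X, ∀ᵐ ω ∂P, dist (f ω) (g ω) ≤ 4 * δ := by
  classical
  rcases isEmpty_or_nonempty Ω with hΩ | ⟨⟨ω₀⟩⟩
  · refine ⟨g, ⟨g.aestronglyMeasurable, fun ω => hΩ.elim ω⟩, .of_forall fun ω => hΩ.elim ω⟩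
  have : Nonempty (BddClosed E) := ⟨X ω₀⟩
  have hδn : ∀ n : ℕ, 0 < δ / 2 ^ n := fun n => by positivity
  choose ν hν using fun n : ℕ => hT.exists_simpleFunc_dist_lt (hδn (n + 1))
  have hpick : ∀ (n : ℕ) (q : BddClosed E × E), ∃ y ∈ q.1,
      infDist q.2 (q.1 : Set E) < 2 * (δ / 2 ^ n) → dist q.2 y < 2 * (δ / 2 ^ n) := by
    rintro n ⟨B, x⟩
    by_cases h : infDist x (B : Set E) < 2 * (δ / 2 ^ n)
    · obtain ⟨y, hy, hxy⟩ := (infDist_lt_iff B.nonempty).1 h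
      exact ⟨y, hy, fun _ => hxy⟩
    · obtain ⟨y, hy⟩ := B.nonempty
      exact ⟨y, hy, fun h' => absurd h' h⟩
  choose pick hpick_mem hpick_dist using hpick
  -- Picking from the finitely many values of `ν n (X ω)` keeps every stage simple. `s n` is within
  -- `δ / 2 ^ n` of `X`, and the jumps `2 * δ / 2 ^ n` add up to `4 * δ`.
  let s : ℕ → SimpleFunc Ω E := fun n =>
    Nat.rec g (fun n u => (((ν n).comp X hX).pair u).map (pick n)) n
  have hs_succ : ∀ n ω, s (n + 1) ω = pick n (ν n (X ω), s n ω) := fun n ω => rfl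
  have hinv : ∀ᵐ ω ∂P, ∀ n, infDist (s n ω) (X ω : Set E) < δ / 2 ^ n := by
    filter_upwards [hXT, hg] with ω hω hgω n
    cases n with
    | zero =>
      rw [pow_zero, div_one]
      exact hgω
    | succ n =>
      refine (BddClosed.infDist_le_add_dist _ (ν n (X ω)) (X ω)).trans_lt ?_
      rw [hs_succ, infDist_zero_of_mem (hpick_mem n (ν n (X ω), s n ω)), zero_add]
      exact hν n _ hω
  have hstep : ∀ᵐ ω ∂P, ∀ n, dist (s n ω) (s (n + 1) ω) ≤ (4 * δ) / 2 / 2 ^ n := by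
    filter_upwards [hXT, hinv] with ω hω hi n
    rw [hs_succ]
    have h1 := BddClosed.infDist_le_add_dist (s n ω) (X ω) (ν n (X ω))
    have h2 := hν n _ hω
    rw [dist_comm] at h2
    have h3 : δ / 2 ^ (n + 1) = δ / 2 ^ n / 2 := by rw [pow_succ]; field_simp
    have h4 := hpick_dist n (ν n (X ω), s n ω) (by linarith [hi n, hδn n])
    calc dist (s n ω) (pick n (ν n (X ω), s n ω)) ≤ 2 * (δ / 2 ^ n) := h4.le
      _ = (4 * δ) / 2 / 2 ^ n := by ring
  have hlim : ∀ᵐ ω ∂P, ∃ y, Tendsto (fun n => s n ω) atTop (𝓝 y) := by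
    filter_upwards [hstep] with ω hω using
      cauchySeq_tendsto_of_complete (cauchySeq_of_le_geometric_two hω)
  have hδ0 : Tendsto (fun n : ℕ => δ / 2 ^ n) atTop (𝓝 0) := by
    have := (tendsto_pow_atTop_nhds_zero_of_lt_one (r := (1 / 2 : ℝ)) (by norm_num)
      (by norm_num)).const_mul δ
    simpa [div_eq_mul_inv] using this
  have hmem : ∀ᵐ ω ∂P, ∃ y ∈ X ω, Tendsto (fun n => s n ω) atTop (𝓝 y) := by
    filter_upwards [hlim, hinv] with ω ⟨y, hy⟩ hi
    refine ⟨y, ?_, hy⟩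
    have h0 : Tendsto (fun n => infDist (s n ω) (X ω : Set E)) atTop (𝓝 0) :=
      squeeze_zero (fun _ => infDist_nonneg) (fun n => (hi n).le) hδ0
    have h1 : Tendsto (fun n => infDist (s n ω) (X ω : Set E)) atTop
        (𝓝 (infDist y (X ω : Set E))) := ((continuous_infDist_pt _).tendsto y).comp hy
    exact ((X ω).isClosed.mem_iff_infDist_zero (X ω).nonempty).2 (tendsto_nhds_unique h1 h0)
  -- A selector must lie in `X ω` for every `ω`, so an arbitrary point is taken on the exceptional
  -- null set.
  have hsel : ∀ ω, ∃ y ∈ X ω, (∃ y ∈ X ω, Tendsto (fun n => s n ω) atTop (𝓝 y)) →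
      Tendsto (fun n => s n ω) atTop (𝓝 y) := fun ω => by
    by_cases h : ∃ y ∈ X ω, Tendsto (fun n => s n ω) atTop (𝓝 y)
    · obtain ⟨y, hy, hy'⟩ := h
      exact ⟨y, hy, fun _ => hy'⟩
    · obtain ⟨y, hy⟩ := (X ω).nonempty
      exact ⟨y, hy, fun h' => absurd h' h⟩
  choose f hfX hf using hsel
  have hft : ∀ᵐ ω ∂P, Tendsto (fun n => s n ω) atTop (𝓝 (f ω)) := hmem.mono fun ω h => hf ω h
  refine ⟨f, ⟨aestronglyMeasurable_of_tendsto_ae atTop (fun n => (s n).aestronglyMeasurable) hft,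
    hfX⟩, ?_⟩
  filter_upwards [hft, hstep] with ω h1 h2
  rw [dist_comm]
  exact dist_le_of_le_geometric_two_of_tendsto₀ h2 h1

end Selectors

/-! ### Random sets with totally bounded range -/

section Frequencies

variable {Ω α : Type*} [MeasurableSpace Ω] {P : Measure Ω} [IsProbabilityMeasure P]
  [MeasurableSpace α]

theorem ae_tendsto_frequency {X : ℕ → Ω → α} (hindep : iIndepFun X P)
    (hident : ∀ n, IdentDistrib (X n) (X 0) P P) (hX : ∀ n, Measurable (X n)) {V : Set α}
    (hV : MeasurableSet V) :
    ∀ᵐ ω ∂P, Tendsto (fun n : ℕ => (∑ i ∈ Finset.range n, V.indicator (1 : α → ℝ) (X i ω)) / n)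
      atTop (𝓝 (P.real (X 0 ⁻¹' V))) := by
  have hm : Measurable (V.indicator (1 : α → ℝ)) := measurable_one.indicator hV
  have heq : (V.indicator (1 : α → ℝ) ∘ X 0) = (X 0 ⁻¹' V).indicator 1 := rfl
  have h := strong_law_ae_real (μ := P) (fun i => V.indicator (1 : α → ℝ) ∘ X i) (by
      rw [heq]
      exact (integrable_const (1 : ℝ)).indicator (hX 0 hV))
    (fun i j hij => (hindep.indepFun hij).comp hm hm) (fun i => (hident i).comp hm)
  have hint : ∫ ω, (V.indicator (1 : α → ℝ) ∘ X 0) ω ∂P = P.real (X 0 ⁻¹' V) := by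
    rw [heq]
    exact integral_indicator_one (hX 0 hV)
  rw [hint] at h
  exact h

/-- If almost all samples have totally bounded range, then the range of the whole process is
almost surely contained in a deterministic totally bounded set. -/
theorem exists_totallyBounded_ae_mem {α : Type*} [MetricSpace α] [MeasurableSpace α]
    [BorelSpace α] {U : Set α} (hU : TopologicalSpace.IsSeparable U) {X : ℕ → Ω → α}
    (hXU : ∀ n ω, X n ω ∈ U) (hindep : iIndepFun X P)
    (hident : ∀ n, IdentDistrib (X n) (X 0) P P) (hX : ∀ n, Measurable (X n))
    (hZ : ∀ᵐ ω ∂P, TotallyBounded (Set.range fun n => X n ω)) :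
    ∃ T : Set α, TotallyBounded T ∧ ∀ᵐ ω ∂P, ∀ n, X n ω ∈ T := by
  obtain ⟨c, hc, hUc⟩ := hU
  let b : α → ℕ → Set α := fun y m => ball y (1 / ((m : ℝ) + 1))
  have hbm : ∀ y m, MeasurableSet (b y m) := fun y m => measurableSet_ball
  -- Essentially the support of the law within `U`, tested on countably many balls. A single good
  -- sample is dense in it, hence total boundedness.
  refine ⟨{A ∈ U | ∀ y ∈ c, ∀ m, A ∈ b y m → 0 < P.real (X 0 ⁻¹' b y m)}, ?_, ?_⟩
  · have hfreq : ∀ᵐ ω ∂P, ∀ y ∈ c, ∀ m, 0 < P.real (X 0 ⁻¹' b y m) → ∃ n, X n ω ∈ b y m := by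
      refine (ae_ball_iff hc).2 fun y _ => ae_all_iff.2 fun m => ?_
      filter_upwards [ae_tendsto_frequency hindep hident hX (hbm y m)] with ω hω hpos
      by_contra! hno
      simp only [Set.indicator_of_notMem (hno _), Finset.sum_const_zero, zero_div] at hω
      exact hpos.ne (tendsto_nhds_unique tendsto_const_nhds hω)
    obtain ⟨ω, hω, hωZ⟩ := (hfreq.and hZ).exists
    refine hωZ.closure.subset ?_
    rintro A ⟨hAU, hA⟩
    refine Metric.mem_closure_iff.2 fun r hr => ?_
    obtain ⟨m, hm⟩ := exists_nat_one_div_lt (half_pos hr)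
    obtain ⟨y, hy, hyA⟩ := Metric.mem_closure_iff.1 (hUc hAU) (1 / ((m : ℝ) + 1)) (by positivity)
    obtain ⟨n, hn⟩ := hω y hy m (hA y hy m hyA)
    refine ⟨X n ω, ⟨n, rfl⟩, ?_⟩
    have h1 : dist (X n ω) y < 1 / ((m : ℝ) + 1) := hn
    have h2 := dist_triangle_right A (X n ω) y
    linarith
  · refine ae_all_iff.2 fun n => ?_
    have h : ∀ᵐ ω ∂P, ∀ y ∈ c, ∀ m, X n ω ∈ b y m → 0 < P.real (X 0 ⁻¹' b y m) := by
      refine (ae_ball_iff hc).2 fun y _ => ae_all_iff.2 fun m => ?_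
      by_cases hp : 0 < P.real (X 0 ⁻¹' b y m)
      · exact .of_forall fun _ _ => hp
      · have h0 : P (X 0 ⁻¹' b y m) = 0 :=
          (measureReal_eq_zero_iff).1 (le_antisymm (not_lt.1 hp) measureReal_nonneg)
        rw [← (hident n).measure_mem_eq (hbm y m)] at h0
        filter_upwards [measure_eq_zero_iff_ae_notMem.1 h0] with ω hω hmem using absurd hmem hω
    filter_upwards [h] with ω hω using ⟨hXU n ω, hω⟩

end Frequencies

/-! ### Convex mixtures of finitely many sets -/

section Mixture

variable {E : Type*} [NormedAddCommGroup E] [NormedSpace ℝ E]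

/-- The sums `∑ B ∈ s, w B • c B` with `c B` in the convex hull of `B`. -/
def mixture (s : Finset (BddClosed E)) (w : BddClosed E → ℝ) : Set E :=
  {y | ∃ c : BddClosed E → E, (∀ B : BddClosed E, c B ∈ convexHull ℝ (B : Set E)) ∧ y = ∑ B ∈ s, w B • c B}

theorem mixture_eq_of_subset {s t : Finset (BddClosed E)} {w : BddClosed E → ℝ} (hst : s ⊆ t)
    (hw : ∀ B ∉ s, w B = 0) : mixture t w = mixture s w := by
  ext y
  have h : ∀ c : BddClosed E → E, ∑ B ∈ s, w B • c B = ∑ B ∈ t, w B • c B := fun c =>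
    Finset.sum_subset hst fun B _ hB => by rw [hw B hB, zero_smul]
  simp only [mixture, Set.mem_ofPred_eq, h]

theorem BddClosed.exists_norm_le_of_mem_convexHull (s : Finset (BddClosed E)) :
    ∃ R : ℝ, ∀ B ∈ s, ∀ x ∈ convexHull ℝ (B : Set E), ‖x‖ ≤ R := by
  have h : Bornology.IsBounded (⋃ B ∈ s, convexHull ℝ (B : Set E)) :=
    (Bornology.isBounded_biUnion_finset s).2 fun B _ => isBounded_convexHull.2 B.isBounded
  obtain ⟨R, hR⟩ := h.exists_norm_le
  exact ⟨R, fun B hB x hx => hR x (Set.mem_biUnion hB hx)⟩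

open scoped Classical in
/-- The proportion of the indices `i < n` with `Y i = B`. -/
noncomputable def frequency (Y : ℕ → BddClosed E) (n : ℕ) (B : BddClosed E) : ℝ :=
  (((Finset.range n).filter fun i => Y i = B).card : ℝ) / n

theorem norm_sum_smul_sub_sum_smul_le {ι : Type*} {s : Finset ι} {w p : ι → ℝ} {c : ι → E} {R : ℝ}
    (hR : ∀ B ∈ s, ‖c B‖ ≤ R) :
    ‖∑ B ∈ s, w B • c B - ∑ B ∈ s, p B • c B‖ ≤ (∑ B ∈ s, |w B - p B|) * R := by
  rw [← Finset.sum_sub_distrib, Finset.sum_mul]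
  refine norm_sum_le_of_le _ fun B hB => ?_
  rw [← sub_smul, norm_smul, Real.norm_eq_abs]
  exact mul_le_mul_of_nonneg_left (hR B hB) (abs_nonneg _)

/-- The terms with `Y i = B` sum to their number times their centroid, which lies in the convex hull
of `B`. So the mean is a mixture with the frequencies as weights, and only the change of weights
costs anything. -/
theorem exists_mem_mixture_norm_mean_sub_le {s : Finset (BddClosed E)} {R : ℝ}
    (hR : ∀ B ∈ s, ∀ x ∈ convexHull ℝ (B : Set E), ‖x‖ ≤ R) (p : BddClosed E → ℝ)
    {Y : ℕ → BddClosed E} (hY : ∀ i, Y i ∈ s) {b : ℕ → E} {n : ℕ}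
    (hb : ∀ i < n, b i ∈ Y i) :
    ∃ y ∈ mixture s p, ‖(n : ℝ)⁻¹ • ∑ i ∈ Finset.range n, b i - y‖ ≤
      (∑ B ∈ s, |frequency Y n B - p B|) * R := by
  classical
  let I : BddClosed E → Finset ℕ := fun B => (Finset.range n).filter fun i => Y i = B
  have hc : ∀ B : BddClosed E, ∃ c ∈ convexHull ℝ (B : Set E),
      ∑ i ∈ I B, b i = ((I B).card : ℝ) • c := by
    intro B
    rcases (I B).eq_empty_or_nonempty with h | h
    · obtain ⟨x, hx⟩ := B.nonempty
      exact ⟨x, subset_convexHull ℝ _ hx, by simp [h]⟩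
    · have hcard : (0 : ℝ) < (I B).card := by exact_mod_cast h.card_pos
      refine ⟨∑ i ∈ I B, ((I B).card : ℝ)⁻¹ • b i, ?_, ?_⟩
      · refine (convex_convexHull ℝ _).sum_mem (fun _ _ => by positivity) ?_ fun i hi => ?_
        · rw [Finset.sum_const, nsmul_eq_mul, mul_inv_cancel₀ hcard.ne']
        · obtain ⟨h1, h2⟩ := Finset.mem_filter.1 hi
          exact subset_convexHull ℝ _ (h2 ▸ hb i (Finset.mem_range.1 h1))
      · rw [← Finset.smul_sum, smul_smul, mul_inv_cancel₀ hcard.ne', one_smul]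
  choose c hc hcs using hc
  refine ⟨_, ⟨c, hc, rfl⟩, ?_⟩
  have hsum : (n : ℝ)⁻¹ • ∑ i ∈ Finset.range n, b i = ∑ B ∈ s, frequency Y n B • c B := by
    rw [← Finset.sum_fiberwise_of_maps_to (s := Finset.range n) (t := s) (g := Y)
      (fun i _ => hY i), Finset.smul_sum]
    refine Finset.sum_congr rfl fun B _ => ?_
    rw [hcs B, smul_smul, frequency, div_eq_inv_mul]
  rw [hsum]
  exact norm_sum_smul_sub_sum_smul_le fun B hB => hR B hB _ (hc B)

/-- Within each group `Y i = B`, the point `c B` is imitated with an error independent of the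
group's size. `K` depends on `y`, not on `n`; this lack of uniformity in `y` is why the convergence
obtained is Fisher's. -/
theorem exists_mean_norm_sub_le_of_mem_mixture {s : Finset (BddClosed E)} {R : ℝ}
    (hR : ∀ B ∈ s, ∀ x ∈ convexHull ℝ (B : Set E), ‖x‖ ≤ R) {p : BddClosed E → ℝ}
    {Y : ℕ → BddClosed E} (hY : ∀ i, Y i ∈ s) {y : E} (hy : y ∈ mixture s p) :
    ∃ K : ℝ, ∀ n : ℕ, ∃ b : ℕ → E, (∀ i, b i ∈ Y i) ∧
      ‖(n : ℝ)⁻¹ • ∑ i ∈ Finset.range n, b i - y‖ ≤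
        K / n + (∑ B ∈ s, |frequency Y n B - p B|) * R := by
  classical
  obtain ⟨c, hc, rfl⟩ := hy
  choose K hK using fun B : BddClosed E => exists_norm_sum_sub_card_smul_le (hc B)
  refine ⟨∑ B ∈ s, K B, fun n => ?_⟩
  choose x hx hxK using fun B => hK B ((Finset.range n).filter fun i => Y i = B)
  refine ⟨fun i => x (Y i) i, fun i => hx _ i, ?_⟩
  refine (norm_sub_le_norm_sub_add_norm_sub _ (∑ B ∈ s, frequency Y n B • c B) _).trans
    (add_le_add ?_ (norm_sum_smul_sub_sum_smul_le fun B hB => hR B hB _ (hc B)))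
  rw [← Finset.sum_fiberwise_of_maps_to (s := Finset.range n) (t := s) (g := Y)
      (fun i _ => hY i), Finset.smul_sum, ← Finset.sum_sub_distrib, Finset.sum_div]
  refine norm_sum_le_of_le _ fun B _ => ?_
  have h : ∑ i ∈ (Finset.range n).filter (fun i => Y i = B), x (Y i) i =
      ∑ i ∈ (Finset.range n).filter (fun i => Y i = B), x B i :=
    Finset.sum_congr rfl fun i hi => by rw [(Finset.mem_filter.1 hi).2]
  rw [h, frequency, div_eq_inv_mul, mul_smul, ← smul_sub, norm_smul, norm_inv, RCLike.norm_natCast,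
    div_eq_inv_mul]
  exact mul_le_mul_of_nonneg_left (hxK B) (by positivity)

end Mixture

/-! ### The Aumann integral and mixtures -/

section Aumann

variable {E : Type*} [NormedAddCommGroup E] {Ω : Type*} [MeasurableSpace Ω] {P : Measure Ω}

theorem IsRandomSet.integrable_of_mem_measurableSelectors {X : Ω → BddClosed E}
    (hX : IsRandomSet P X) {f : Ω → E} (hf : f ∈ measurableSelectors P X) : Integrable f P := by
  refine hX.integrable_norm.mono' hf.1 (.of_forall fun ω => ?_)
  obtain ⟨R, hR⟩ := (X ω).isBounded.exists_norm_le
  exact le_csSup ⟨R, by rintro _ ⟨x, hx, rfl⟩; exact hR x hx⟩ ⟨f ω, hf.2 ω, rfl⟩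

variable [NormedSpace ℝ E]

theorem MeasureTheory.SimpleFunc.sum_setIntegral_fiber {β : Type*} (φ : SimpleFunc Ω β)
    {f : Ω → E} (hf : Integrable f P) :
    ∫ ω, f ω ∂P = ∑ b ∈ φ.range, ∫ ω in φ ⁻¹' {b}, f ω ∂P := by
  rw [← integral_biUnion_finset φ.range (fun b _ => φ.measurableSet_fiber b) (fun a _ b _ hab =>
    Disjoint.preimage φ (Set.disjoint_singleton.2 hab)) fun _ _ => hf.integrableOn]
  have h : (⋃ b ∈ φ.range, φ ⁻¹' {b}) = Set.univ := Set.eq_univ_of_forall fun ω =>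
    Set.mem_biUnion (φ.mem_range_self ω) rfl
  rw [h, setIntegral_univ]

variable [CompleteSpace E] [IsProbabilityMeasure P] {X : Ω → BddClosed E}

/-- The integral of a selector of `X` is close to a mixture of the values of an approximation of
`X` by a simple function. -/
theorem exists_mem_mixture_norm_integral_sub_le (Y : SimpleFunc Ω (BddClosed E)) {ε : ℝ}
    (hε : 0 < ε) (hYX : ∀ᵐ ω ∂P, dist (Y ω) (X ω) < ε) {f : Ω → E} (hfX : ∀ ω, f ω ∈ X ω)
    (hf : Integrable f P) :
    ∃ y ∈ mixture Y.range (fun B => P.real (Y ⁻¹' {B})), ‖∫ ω, f ω ∂P - y‖ ≤ 2 * ε := by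
  have hc : ∀ B : BddClosed E, ∃ c ∈ convexHull ℝ (B : Set E),
      ‖∫ ω in Y ⁻¹' {B}, f ω ∂P - P.real (Y ⁻¹' {B}) • c‖ ≤ P.real (Y ⁻¹' {B}) * (2 * ε) := by
    intro B
    rcases eq_or_ne (P (Y ⁻¹' {B})) 0 with h0 | h0
    · obtain ⟨x, hx⟩ := B.nonempty
      refine ⟨x, subset_convexHull ℝ _ hx, ?_⟩
      simp [Measure.real, h0, Measure.restrict_eq_zero.2 h0]
    -- A closed convex set contains the averages of its points. Returning from the closed
    -- `ε`-thickening to a point of the hull is what turns `ε` into `2 * ε`.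
    · have hmem : (⨍ ω in Y ⁻¹' {B}, f ω ∂P) ∈ cthickening ε (convexHull ℝ (B : Set E)) := by
        refine ((convex_convexHull ℝ _).cthickening ε).set_average_mem isClosed_cthickening h0
          (measure_ne_top _ _) ?_ hf.integrableOn
        rw [ae_restrict_iff' (Y.measurableSet_fiber B)]
        filter_upwards [hYX] with ω hω hB
        rw [show Y ω = B from hB, dist_comm] at hω
        obtain ⟨y, hy, hxy⟩ := BddClosed.exists_dist_lt hω (hfX ω)
        exact thickening_subset_cthickening _ _
          (mem_thickening_iff.2 ⟨y, subset_convexHull ℝ _ hy, hxy⟩)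
      obtain ⟨c, hc, hdist⟩ := mem_thickening_iff.1
        (cthickening_subset_thickening' (δ₂ := 2 * ε) (by linarith) (by linarith) _ hmem)
      refine ⟨c, hc, ?_⟩
      have hp : P.real (Y ⁻¹' {B}) ≠ 0 := (measureReal_eq_zero_iff).not.2 h0
      have hav : ∫ ω in Y ⁻¹' {B}, f ω ∂P =
          P.real (Y ⁻¹' {B}) • ⨍ ω in Y ⁻¹' {B}, f ω ∂P := by
        rw [setAverage_eq, smul_smul, mul_inv_cancel₀ hp, one_smul]
      rw [hav, ← smul_sub, norm_smul, Real.norm_of_nonneg measureReal_nonneg, ← dist_eq_norm]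
      exact mul_le_mul_of_nonneg_left hdist.le measureReal_nonneg
  choose c hc hcn using hc
  refine ⟨_, ⟨c, hc, rfl⟩, ?_⟩
  rw [Y.sum_setIntegral_fiber hf, ← Finset.sum_sub_distrib]
  refine (norm_sum_le_of_le _ fun B _ => hcn B).trans ?_
  have h1 : ∑ B ∈ Y.range, P.real (Y ⁻¹' {B}) = 1 := by
    have := Y.sum_setIntegral_fiber (P := P) (integrable_const (1 : ℝ))
    simpa using this.symm
  rw [← Finset.sum_mul, h1, one_mul]

/-- On an atomless space, every mixture of the values of an approximation of `X` by a simple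
function is close to the integral of a selector of `X`. -/
theorem exists_measurableSelector_norm_integral_sub_le (hP : IsAtomless P) (hX : IsRandomSet P X)
    (hXm : Measurable X) {T : Set (BddClosed E)} (hT : TotallyBounded T)
    (hXT : ∀ᵐ ω ∂P, X ω ∈ T) (Y : SimpleFunc Ω (BddClosed E)) {ε : ℝ} (hε : 0 < ε)
    (hYX : ∀ᵐ ω ∂P, dist (Y ω) (X ω) < ε) {y : E}
    (hy : y ∈ mixture Y.range (fun B => P.real (Y ⁻¹' {B}))) :
    ∃ f ∈ measurableSelectors P X, ‖∫ ω, f ω ∂P - y‖ ≤ 4 * ε := by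
  obtain ⟨c, hc, rfl⟩ := hy
  -- `G B` averages to `c B` on the fibre over `B`; `Y.bind G` glues these into a simple selector of
  -- `Y`.
  choose G hG hGint using fun B : BddClosed E => exists_setIntegral_eq_of_mem_convexHull hP (hc B)
    (Y.measurableSet_fiber B)
  have hgY : ∀ ω, Y.bind G ω ∈ Y ω := fun ω => hG (Y ω) ω
  obtain ⟨f, hf, hfg⟩ := exists_measurableSelector_dist_le hXm hT hXT (Y.bind G) hε (by
    filter_upwards [hYX] with ω hω
    refine (BddClosed.infDist_le_add_dist _ (Y ω) (X ω)).trans_lt ?_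
    rwa [infDist_zero_of_mem (hgY ω), zero_add])
  refine ⟨f, hf, ?_⟩
  have hgi : Integrable (Y.bind G) P := (Y.bind G).integrable_of_isFiniteMeasure
  have hint : ∫ ω, Y.bind G ω ∂P = ∑ B ∈ Y.range, P.real (Y ⁻¹' {B}) • c B := by
    rw [Y.sum_setIntegral_fiber hgi]
    refine Finset.sum_congr rfl fun B _ => ?_
    rw [← hGint B]
    refine setIntegral_congr_fun (Y.measurableSet_fiber B) fun ω hω => ?_
    rw [SimpleFunc.bind_apply, show Y ω = B from hω]
  rw [← hint, ← integral_sub (hX.integrable_of_mem_measurableSelectors hf) hgi]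
  simpa using norm_integral_le_of_norm_le_const (μ := P) (C := 4 * ε)
    (hfg.mono fun ω hω => by rwa [← dist_eq_norm])

end Aumann

/-! ### Minkowski means -/

section Minkowski

variable {E : Type*} [NormedAddCommGroup E]

/-- Distances to `A n` are 1-Lipschitz, so convergence on a finite `ε / 2`-net of `C` controls all
of `C`. -/
theorem FisherTendsto.hausdorffTendsto {A : ℕ → Set E} {C : Set E} (h : FisherTendsto A C)
    (hC : IsCompact C) : HausdorffTendsto A C := by
  refine ENNReal.tendsto_nhds_zero.2 fun ε hε => ?_
  have hε2 : 0 < ε / 2 := ENNReal.half_pos hε.ne'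
  obtain ⟨t, htC, htf, hCt⟩ := EMetric.totallyBounded_iff'.1 hC.totallyBounded _ hε2
  have h2 : ∀ᶠ n in atTop, ∀ z ∈ t, infEDist z (A n) ≤ ε / 2 :=
    (eventually_all_finite htf).2 fun z hz => ENNReal.tendsto_nhds_zero.1 (h.2 z (htC hz)) _ hε2
  filter_upwards [ENNReal.tendsto_nhds_zero.1 h.1 ε hε, h2] with n h1 h2
  refine hausdorffEDist_le_of_infEDist (fun x hx => (le_iSup₂ x hx).trans h1) fun x hx => ?_
  obtain ⟨z, hz, hxz⟩ := Set.mem_iUnion₂.1 (hCt hx)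
  calc infEDist x (A n) ≤ infEDist z (A n) + edist x z := infEDist_le_infEDist_add_edist
    _ ≤ ε / 2 + ε / 2 := add_le_add (h2 z hz) (le_of_lt hxz)
    _ = ε := ENNReal.add_halves ε

variable [NormedSpace ℝ E]

theorem excess_minkowskiMean_le {A : ℕ → Set E} {C : Set E} {n : ℕ} {r : ℝ≥0∞}
    (h : ∀ x : ℕ → E, (∀ i < n, x i ∈ A i) →
      infEDist ((n : ℝ)⁻¹ • ∑ i ∈ Finset.range n, x i) C ≤ r) :
    excess (minkowskiMean A n) C ≤ r := by
  refine iSup₂_le ?_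
  rintro _ ⟨u, hu, rfl⟩
  have hcl : IsClosed {u : E | infEDist ((n : ℝ)⁻¹ • u) C ≤ r} :=
    isClosed_le (continuous_infEDist.comp (continuous_const_smul _)) continuous_const
  refine closure_minimal ?_ hcl hu
  intro v hv
  obtain ⟨x, hx, rfl⟩ := (Set.mem_finsetSum _ _ _).1 hv
  exact h x fun i hi => hx (Finset.mem_range.2 hi)

theorem smul_sum_mem_minkowskiMean {A : ℕ → Set E} {n : ℕ} {x : ℕ → E} (hx : ∀ i < n, x i ∈ A i) :
    (n : ℝ)⁻¹ • ∑ i ∈ Finset.range n, x i ∈ minkowskiMean A n :=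
  Set.smul_mem_smul_set (subset_closure ((Set.mem_finsetSum _ _ _).2
    ⟨x, fun hi => hx _ (Finset.mem_range.1 hi), rfl⟩))

theorem dist_mean_mean_le {x b : ℕ → E} {n : ℕ} {ε : ℝ} (hε : 0 ≤ ε)
    (h : ∀ i < n, dist (x i) (b i) ≤ ε) :
    dist ((n : ℝ)⁻¹ • ∑ i ∈ Finset.range n, x i) ((n : ℝ)⁻¹ • ∑ i ∈ Finset.range n, b i) ≤ ε := by
  rcases n.eq_zero_or_pos with rfl | hn
  · simpa
  rw [dist_eq_norm, ← smul_sub, ← Finset.sum_sub_distrib, norm_smul, norm_inv, RCLike.norm_natCast,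
    inv_mul_le_iff₀ (by exact_mod_cast hn)]
  refine (norm_sum_le_of_le _ fun i hi => ?_).trans_eq (b := ∑ _i ∈ Finset.range n, ε) (by simp)
  rw [← dist_eq_norm]
  exact h i (Finset.mem_range.1 hi)

end Minkowski

/-! ### The strong law of large numbers -/

section StrongLaw

variable {E : Type*} [NormedAddCommGroup E]
  {Ω : Type*} [MeasurableSpace Ω] {P : Measure Ω} [IsProbabilityMeasure P]

theorem ae_tendsto_sum_abs_frequency_sub {X : ℕ → Ω → BddClosed E} (hindep : iIndepFun X P)
    (hident : ∀ n, IdentDistrib (X n) (X 0) P P) (hX : ∀ n, Measurable (X n))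
    (ν : SimpleFunc (BddClosed E) (BddClosed E)) :
    ∀ᵐ ω ∂P, Tendsto (fun n => ∑ B ∈ ν.range, |frequency (fun i => ν (X i ω)) n B -
      P.real (ν.comp (X 0) (hX 0) ⁻¹' {B})|) atTop (𝓝 0) := by
  have h : ∀ᵐ ω ∂P, ∀ B ∈ ν.range, Tendsto (fun n => frequency (fun i => ν (X i ω)) n B) atTop
      (𝓝 (P.real (ν.comp (X 0) (hX 0) ⁻¹' {B}))) := by
    refine (ae_ball_iff ν.range.countable_toSet).2 fun B _ => ?_
    filter_upwards [ae_tendsto_frequency hindep hident hX (ν.measurableSet_fiber B)] with ω hω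
    convert! hω using 3 with n
    classical
    rw [frequency, Finset.card_filter, Nat.cast_sum]
    congr 1
    refine Finset.sum_congr rfl fun i _ => ?_
    simp [Set.indicator_apply]
  filter_upwards [h] with ω hω
  have hsum := tendsto_finsetSum ν.range fun B hB => ((hω B hB).sub_const
    (P.real (ν.comp (X 0) (hX 0) ⁻¹' {B}))).abs
  simpa using hsum

variable [NormedSpace ℝ E] [CompleteSpace E]

/-- The excess costs `ε` for replacing `X` by `ν ∘ X`, `ε` for the frequencies and `4 * ε` for the
selector; the other half costs `5 * ε`. Only convergence of finitely many frequencies is used, so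
the null set does not depend on `z`. -/
theorem ae_eventually_minkowskiMean_close (hP : IsAtomless P) {X : ℕ → Ω → BddClosed E}
    (hX : IsRandomSet P (X 0)) (hindep : iIndepFun X P)
    (hident : ∀ n, IdentDistrib (X n) (X 0) P P) (hXm : ∀ n, Measurable (X n))
    {T : Set (BddClosed E)} (hT : TotallyBounded T) (hXT : ∀ᵐ ω ∂P, ∀ n, X n ω ∈ T) {ε : ℝ}
    (hε : 0 < ε) :
    ∀ᵐ ω ∂P, (∀ᶠ n in atTop, excess (minkowskiMean (fun i => (X i ω : Set E)) n)
        (setExpectation P (X 0)) ≤ ENNReal.ofReal (6 * ε)) ∧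
      ∀ z ∈ setExpectation P (X 0), ∀ᶠ n in atTop,
        infEDist z (minkowskiMean (fun i => (X i ω : Set E)) n) ≤ ENNReal.ofReal (6 * ε) := by
  obtain ⟨ω₀⟩ := nonempty_of_isProbabilityMeasure P
  have : Nonempty (BddClosed E) := ⟨X 0 ω₀⟩
  obtain ⟨ν, hν⟩ := hT.exists_simpleFunc_dist_lt hε
  obtain ⟨R, hR⟩ := BddClosed.exists_norm_le_of_mem_convexHull ν.range
  set Y := ν.comp (X 0) (hXm 0)
  set p : BddClosed E → ℝ := fun B => P.real (Y ⁻¹' {B})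
  have hmix : mixture ν.range p = mixture Y.range p :=
    mixture_eq_of_subset (ν.range_comp_subset_range (hXm 0)) fun B hB => by
      simp only [p, (SimpleFunc.preimage_eq_empty_iff Y B).2 hB, measureReal_empty]
  have hXT0 : ∀ᵐ ω ∂P, X 0 ω ∈ T := hXT.mono fun ω h => h 0
  have hYX : ∀ᵐ ω ∂P, dist (Y ω) (X 0 ω) < ε := hXT0.mono fun ω h => hν _ h
  filter_upwards [hXT, ae_tendsto_sum_abs_frequency_sub hindep hident hXm ν] with ω hωT hω
  have hω' := hω.mul_const R
  rw [zero_mul] at hω'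
  have hνX : ∀ i, dist (ν (X i ω)) (X i ω) < ε := fun i => hν _ (hωT i)
  have hmem : ∀ i, ν (X i ω) ∈ ν.range := fun i => ν.mem_range_self _
  constructor
  · filter_upwards [hω'.eventually (gt_mem_nhds hε)] with n hn
    refine excess_minkowskiMean_le fun x hx => ?_
    have hb : ∀ i, ∃ b, i < n → b ∈ ν (X i ω) ∧ dist (x i) b < ε := fun i => by
      by_cases hi : i < n
      · obtain ⟨b, hb⟩ := BddClosed.exists_dist_lt (dist_comm (ν (X i ω)) (X i ω) ▸ hνX i) (hx i hi)
        exact ⟨b, fun _ => hb⟩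
      · exact ⟨0, fun h => absurd h hi⟩
    choose b hb using hb
    obtain ⟨y, hy, hby⟩ := exists_mem_mixture_norm_mean_sub_le hR p hmem fun i hi => (hb i hi).1
    obtain ⟨f, hf, hfy⟩ := exists_measurableSelector_norm_integral_sub_le hP hX (hXm 0) hT hXT0 Y
      hε hYX (hmix ▸ hy)
    have hfC : ∫ ω, f ω ∂P ∈ setExpectation P (X 0) := subset_closure ⟨f, hf, rfl⟩
    refine (infEDist_le_edist_of_mem hfC).trans ?_
    rw [edist_dist]
    refine ENNReal.ofReal_le_ofReal ?_
    have h1 := dist_mean_mean_le hε.le fun i hi => (hb i hi).2.le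
    rw [← dist_eq_norm] at hby hfy
    have h2 := dist_triangle4_right ((n : ℝ)⁻¹ • ∑ i ∈ Finset.range n, x i) (∫ ω, f ω ∂P)
      ((n : ℝ)⁻¹ • ∑ i ∈ Finset.range n, b i) y
    linarith
  · intro z hz
    obtain ⟨_, ⟨f, hf, rfl⟩, hzf⟩ := Metric.mem_closure_iff.1 hz ε hε
    obtain ⟨y, hy, hfy⟩ := exists_mem_mixture_norm_integral_sub_le Y hε hYX hf.2
      (hX.integrable_of_mem_measurableSelectors hf)
    obtain ⟨K, hK⟩ := exists_mean_norm_sub_le_of_mem_mixture hR hmem (hmix.symm ▸ hy)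
    have hlim := (tendsto_const_div_atTop_nhds_zero_nat K).add hω'
    rw [add_zero] at hlim
    filter_upwards [hlim.eventually (gt_mem_nhds hε)] with n hn
    obtain ⟨b, hb, hby⟩ := hK n
    choose x hx hbx using fun i => BddClosed.exists_dist_lt (hνX i) (hb i)
    refine (infEDist_le_edist_of_mem
      (smul_sum_mem_minkowskiMean (A := fun i => (X i ω : Set E)) fun i _ => hx i)).trans ?_
    rw [edist_dist]
    refine ENNReal.ofReal_le_ofReal ?_
    have h1 := dist_mean_mean_le (n := n) hε.le fun i _ => (hbx i).le
    rw [← dist_eq_norm] at hby hfy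
    have h2 := dist_triangle4 z (∫ ω, f ω ∂P) y ((n : ℝ)⁻¹ • ∑ i ∈ Finset.range n, b i)
    rw [dist_comm y] at h2
    have h3 := dist_triangle z ((n : ℝ)⁻¹ • ∑ i ∈ Finset.range n, b i)
      ((n : ℝ)⁻¹ • ∑ i ∈ Finset.range n, x i)
    linarith

/-- Strong law of large numbers in the sense of Fisher, for random sets with totally bounded
range. -/
theorem ae_fisherTendsto_minkowskiMean (hP : IsAtomless P) {X : ℕ → Ω → BddClosed E}
    (hX : IsRandomSet P (X 0)) (hindep : iIndepFun X P)
    (hident : ∀ n, IdentDistrib (X n) (X 0) P P) (hXm : ∀ n, Measurable (X n))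
    {T : Set (BddClosed E)} (hT : TotallyBounded T) (hXT : ∀ᵐ ω ∂P, ∀ n, X n ω ∈ T) :
    ∀ᵐ ω ∂P, FisherTendsto (minkowskiMean fun i => (X i ω : Set E)) (setExpectation P (X 0)) := by
  let ε : ℕ → ℝ := fun k => 1 / ((k : ℝ) + 1) / 6
  have hε : ∀ δ : ℝ≥0∞, 0 < δ → ∃ k, ENNReal.ofReal (6 * ε k) ≤ δ := by
    intro δ hδ
    have h : Tendsto (fun k => ENNReal.ofReal (6 * ε k)) atTop (𝓝 0) := by
      have h6 : ∀ k, 6 * ε k = 1 / ((k : ℝ) + 1) := fun k => by simp only [ε]; ring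
      simp only [h6]
      rw [← ENNReal.ofReal_zero]
      exact ENNReal.tendsto_ofReal tendsto_one_div_add_atTop_nhds_zero_nat
    exact (ENNReal.tendsto_nhds_zero.1 h δ hδ).exists
  -- Countably many tolerances, so that the exceptional sets unite to a null set.
  have h := ae_all_iff.2 fun k => ae_eventually_minkowskiMean_close hP hX hindep hident hXm hT hXT
    (ε := ε k) (by positivity)
  filter_upwards [h] with ω hω
  refine ⟨ENNReal.tendsto_nhds_zero.2 fun δ hδ => ?_,
    fun z hz => ENNReal.tendsto_nhds_zero.2 fun δ hδ => ?_⟩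
  · obtain ⟨k, hk⟩ := hε δ hδ
    exact (hω k).1.mono fun n hn => hn.trans hk
  · obtain ⟨k, hk⟩ := hε δ hδ
    exact ((hω k).2 z hz).mono fun n hn => hn.trans hk

end StrongLaw

theorem theorem6p2 {E : Type*} [NormedAddCommGroup E] [NormedSpace ℝ E] [CompleteSpace E]
    {Ω : Type*} [MeasurableSpace Ω] (P : Measure Ω) [IsProbabilityMeasure P] [P.IsComplete]
    (hP : IsAtomless P)
    (U : Set (BddClosed E)) (hU : TopologicalSpace.IsSeparable U)
    (X : ℕ → Ω → BddClosed E) (hXU : ∀ n ω, X n ω ∈ U)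
    (hX : ∀ n, IsRandomSet P (X n))
    (hindep : iIndepFun X P) (hident : ∀ n, IdentDistrib (X n) (X 0) P P)
    (C : Set E) (hC : ∀ n, setExpectation P (X n) = C)
    (hZ : ∀ᵐ ω ∂P, ∃ Z : Set (BddClosed E), IsCompact Z ∧ Z ⊆ U ∧ ∀ n, X n ω ∈ Z) :
    (∀ᵐ ω ∂P, FisherTendsto (minkowskiMean fun i => (X i ω : Set E)) C) ∧
      (IsCompact C →
        ∀ᵐ ω ∂P, HausdorffTendsto (minkowskiMean fun i => (X i ω : Set E)) C) := by
  -- Identical distribution includes a.e. measurability, which completeness of `P` upgrades to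
  -- measurability.
  have hXm : ∀ n, Measurable (X n) := fun n =>
    (hident n).aemeasurable_fst.nullMeasurable.measurable_of_complete
  obtain ⟨T, hT, hXT⟩ := exists_totallyBounded_ae_mem hU hXU hindep hident hXm (by
    filter_upwards [hZ] with ω ⟨Z, hZc, _, hXZ⟩
    exact hZc.totallyBounded.subset (Set.range_subset_iff.2 hXZ))
  have h := ae_fisherTendsto_minkowskiMean hP (hX 0) hindep hident hXm hT hXT
  rw [hC 0] at h
  exact ⟨h, fun hCc => h.mono fun ω hω => hω.hausdorffTendsto hCc⟩
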